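/- **Setting.** Let $E$ be a finite set of agents, $\mathcal F\subseteq 2^E$ a nonempty family of feasible solutions, $\prec$ a strict total order on $\mathcal F$ (the tie-breaking rule), and $\mathbf D=(D_e)_{e\in E}$ a three-value type domain: each $D_e$ is a nonempty set of reals with $D_e\subseteq\{L_e,M_e,H_e\}$ for some $L_e<M_e<H_e$. An *extensive-form mechanism* is a well-founded tree. Each internal vertex $u$ queries one agent $S(u)$, who takes one of finitely many actions, the action depending only on her type. Each leaf carries a solution in $\mathcal F$ and a payment $p_i\in\mathbb R$ to each agent $i$. For $\mathbf b\in\prod_e D_e$, let $f(\mathbf b)$ and $p(\mathbf b)$ be the solution and the payments at the leaf reached when all agents act according to $\mathbf b$. A profile is compatible with $u$ if it leads to $u$; two profiles compatible with $u$ diverge at $u$ if $S(u)$ takes different actions under them. An agent $i$ of type $t$ has utility $u_i(t,\mathbf b)=p_i(\mathbf b)-t\cdot\mathbf 1[i\in f(\mathbf b)]$. The mechanism is *OSP* (obviously strategyproof) if for every vertex $u$ with $i=S(u)$ and all profiles $\mathbf b,\mathbf b'$ compatible with $u$ that diverge at $u$, $u_i(b_i,\mathbf b)\ge u_i(b_i,\mathbf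 b')$. It is *optimal* if for every $\mathbf b\in\prod_e D_e$, $f(\mathbf b)$ is the $\prec$-first among the solutions $P\in\mathcal F$ minimizing $\sum_{e\in P}b_e$. A *subdomain* of $\mathbf D$ is a family $\tilde{\mathbf D}=(\tilde D_e)_{e\in E}$ with $\emptyset\ne\tilde D_e\subseteq D_e$. Write $L(e)=\min\tilde D_e$, $H(e)=\max\tilde D_e$, $L(P)=\sum_{e\in P}L(e)$, $H(P)=\sum_{e\in P}H(e)$, and $(\tilde{\mathbf D}_{-f},t)$ for $\tilde{\mathbf D}$ with $\tilde D_f$ replaced by $\{t\}$. A solution $P\in\mathcal F$ is *selectable* for $\tilde{\mathbf D}$ if for every other $P'\in\mathcal F$ either $L(P\setminus P')<H(P'\setminus P)$, or $L(P\setminus P')=H(P'\setminus P)$ and $P\prec P'$. It is *strongly selectable* for $\tilde{\mathbf D}$ if it is selectable for $\tilde{\mathbf D}$ and, for every $e\in P$, also for $(\tilde{\mathbf D}_{-e},H(e))$. **Condition 1 for $\tilde{\mathbf D}$.** Let $\mathcal S$ be the set of strongly selectable solutions for $\tilde{\mathbf D}$. (i) Some $P\in\mathcal S$ contains some $f$ with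 $|\tilde D_f|>1$. (ii) For every $P\in\mathcal S$ and every $f\in P$ with $|\tilde D_f|>1$ there is $Q\in\mathcal S$ with $f\notin Q$ that is selectable for $(\tilde{\mathbf D}_{-f},L(f))$. **Condition 2 for $\tilde{\mathbf D}$.** Let $\mathcal S$ be the set of selectable solutions for $\tilde{\mathbf D}$. (i) $|\mathcal S|\ge2$ and some $P\in\mathcal S$ is not strongly selectable. (ii) For every $f$ that belongs to some but not all members of $\mathcal S$, there is $Q\in\mathcal S$ with $f\notin Q$ that is selectable for $(\tilde{\mathbf D}_{-f},L(f))$, and there is $Q'\in\mathcal S$ with $f\in Q'$ that is selectable for $(\tilde{\mathbf D}_{-f},H(f))$. **Algorithm $M_1$.** Start with $\tilde{\mathbf D}=\mathbf D$. At each step let $\mathcal P$ be the set of solutions selectable for the current $\tilde{\mathbf D}$. An agent $f$ with $|\tilde D_f|>1$ that lies in some $P\in\mathcal P$ is an *ascending pick* if no $P\in\mathcal P$ with $f\notin P$ is selectable for $(\tilde{\mathbf D}_{-f},L(f))$, and a *descending pick* if no $P\in\mathcal P$ with $f\in P$ is selectable for $(\tilde{\mathbf D}_{-f},H(f))$. -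 If $|\mathcal P|=1$, return its only element. - Otherwise, if some $P\in\mathcal P$ is not strongly selectable: ask an ascending pick $f$ whether her type is $L(f)$ if there is an ascending pick; if there is none, ask a descending pick $f$ whether her type is $H(f)$. - Otherwise, ask an ascending pick $f$ whether her type is $L(f)$. On the answer "yes" to a query for type $t$, replace $\tilde D_f$ by $\{t\}$; on "no", remove $t$ from $\tilde D_f$. Then repeat. **Theorem.** An optimal OSP mechanism for $(E,\mathcal F,\mathbf D)$ exists if and only if no subdomain of $\mathbf D$ satisfies Condition 1 or Condition 2. Moreover, if an optimal OSP mechanism exists, then 1. Algorithm $M_1$ can be carried out, starting from $\mathbf D$ and likewise from every subdomain of $\mathbf D$: for a suitable choice of the picks it yields a complete finite implementation tree; 2. every implementation tree that Algorithm $M_1$ yields from $\mathbf D$, for any choice of the picks, becomes an optimal OSP mechanism when suitable payments are added at its leaves. -/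

import Mathlib

/-- A type domain of the agents: a nonempty finite set of possible costs for every agent. -/
@[ext] structure TypeDomain (E : Type*) where
  vals : E → Finset ℝ
  nonempty : ∀ e, (vals e).Nonempty

namespace TypeDomain

variable {E : Type*}

/-- `D'` is a subdomain of `D`. -/
def IsSubdomain (D' D : TypeDomain E) : Prop := ∀ e, D'.vals e ⊆ D.vals e

/-- The set of type profiles of a domain. -/
def profiles (D : TypeDomain E) : Set (E → ℝ) := {b | ∀ e, b e ∈ D.vals e}

/-- `L(e, D)`, the lowest type of `e`. -/
noncomputable def low (D : TypeDomain E) (e : E) : ℝ := (D.vals e).min' (D.nonempty e)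

/-- `H(e, D)`, the highest type of `e`. -/
noncomputable def high (D : TypeDomain E) (e : E) : ℝ := (D.vals e).max' (D.nonempty e)

/-- `L(P, D)`, the lowest possible cost of a set of elements. -/
noncomputable def lowCost (D : TypeDomain E) (P : Finset E) : ℝ := ∑ e ∈ P, D.low e

/-- `H(P, D)`, the highest possible cost of a set of elements. -/
noncomputable def highCost (D : TypeDomain E) (P : Finset E) : ℝ := ∑ e ∈ P, D.high e

/-- `(D_{-f}, t)`: the domain of `f` is replaced by the singleton `{t}`. -/
def fix [DecidableEq E] (D : TypeDomain E) (f : E) (t : ℝ) : TypeDomain E where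
  vals := Function.update D.vals f {t}
  nonempty := by
    intro e
    by_cases h : e = f
    · subst h; simp
    · simpa [Function.update_of_ne h] using D.nonempty e

end TypeDomain

/-- Finite (well-founded) implementation trees with leaves labelled by `O`. At the vertex
`node i k act child` agent `i` is queried and has `k` actions, `act t` being the action compatible
with type `t`. So, if `X` is the set of profiles compatible with the vertex, its `j`-th outgoing
edge is labelled by `{b ∈ X | act (b i) = j}`: these labels partition `X`, and membership in a
label depends, within `X`, on the type of agent `i` only. -/
inductive ImplTree (E : Type*) (O : Type*) where
  | leaf (x : O) : ImplTree E O
  | node (i : E) (k : ℕ) (act : ℝ → Fin k) (child : Fin k → ImplTree E O) : ImplTree E O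

namespace ImplTree

variable {E O O' : Type*}

/-- The label of the leaf that is reached when the agents act according to the profile `b`. -/
def run : ImplTree E O → (E → ℝ) → O
  | leaf x, _ => x
  | node i _ act child, b => (child (act (b i))).run b

/-- Relabelling of the leaves. -/
def map (g : O → O') : ImplTree E O → ImplTree E O'
  | leaf x => leaf (g x)
  | node i k act child => node i k act fun j => (child j).map g

/-- Ask agent `i` whether her type is `t`. -/
noncomputable def ask (i : E) (t : ℝ) (yes no : ImplTree E O) : ImplTree E O :=
  node i 2 (fun s => if s = t then 0 else 1) ![yes, no]

end ImplTree

namespace SetSystem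

variable {E : Type*} [DecidableEq E] {F : Finset (Finset E)}

/-- An extensive-form mechanism for the set system `(E, F)`: an implementation tree whose leaves
carry a feasible solution and a payment to every agent. -/
abbrev Mechanism (F : Finset (Finset E)) : Type _ := ImplTree E (F × (E → ℝ))

/-- Quasi-linear utility of agent `i` with type `t`: her payment, minus `t` if she is selected. -/
noncomputable def utility (i : E) (t : ℝ) (x : F × (E → ℝ)) : ℝ :=
  x.2 i - if i ∈ x.1.1 then t else 0

/-- Obvious strategyproofness at all vertices of a (sub)tree whose root has `X` as its set of
compatible profiles: whenever `b, b' ∈ X` diverge at the root, which queries agent `i`, the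
utility of `i` with true type `b i` is at `b` at least what it is at `b'`. On profiles
compatible with a vertex, the outcome of the whole mechanism is that of the subtree there. -/
def OSPFrom : Mechanism F → Set (E → ℝ) → Prop
  | .leaf _, _ => True
  | .node i k act child, X =>
      (∀ b ∈ X, ∀ b' ∈ X, act (b i) ≠ act (b' i) →
        utility i (b i) ((ImplTree.node i k act child).run b')
          ≤ utility i (b i) ((ImplTree.node i k act child).run b)) ∧
      ∀ j, OSPFrom (child j) {b ∈ X | act (b i) = j}

/-- The mechanism is obviously strategyproof on the type domain `D`. -/
def IsOSP (D : TypeDomain E) (M : Mechanism F) : Prop := OSPFrom M D.profiles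

/-- `P` is the solution of minimum social cost for `b`, ties being broken in favour of the
solution that comes first in the order `prec`. -/
def IsOptimum (prec : F → F → Prop) (b : E → ℝ) (P : F) : Prop :=
  ∀ Q : F, Q ≠ P →
    ∑ e ∈ P.1, b e < ∑ e ∈ Q.1, b e ∨ (∑ e ∈ P.1, b e = ∑ e ∈ Q.1, b e ∧ prec P Q)

/-- The mechanism returns the optimum at every profile of the domain. -/
def IsOptimal (prec : F → F → Prop) (D : TypeDomain E) (M : Mechanism F) : Prop :=
  ∀ b ∈ D.profiles, IsOptimum prec b (M.run b).1

/-- Selectable solutions. -/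
def Selectable (prec : F → F → Prop) (D : TypeDomain E) (P : F) : Prop :=
  ∀ P' : F, P' ≠ P →
    D.lowCost (P.1 \ P'.1) < D.highCost (P'.1 \ P.1) ∨
      (D.lowCost (P.1 \ P'.1) = D.highCost (P'.1 \ P.1) ∧ prec P P')

/-- Strongly selectable solutions. -/
def StronglySelectable (prec : F → F → Prop) (D : TypeDomain E) (P : F) : Prop :=
  Selectable prec D P ∧ ∀ e ∈ P.1, Selectable prec (D.fix e (D.high e)) P

/-- First obstruction at a subdomain. -/
def ObstructionOne (prec : F → F → Prop) (D : TypeDomain E) : Prop :=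
  (∃ P : F, StronglySelectable prec D P ∧ ∃ f ∈ P.1, 1 < (D.vals f).card) ∧
  ∀ P : F, StronglySelectable prec D P → ∀ f ∈ P.1, 1 < (D.vals f).card →
    ∃ Q : F, StronglySelectable prec D Q ∧ f ∉ Q.1 ∧ Selectable prec (D.fix f (D.low f)) Q

/-- Second obstruction at a subdomain. -/
def ObstructionTwo (prec : F → F → Prop) (D : TypeDomain E) : Prop :=
  ({P : F | Selectable prec D P}.Nontrivial ∧
    ∃ P : F, Selectable prec D P ∧ ¬ StronglySelectable prec D P) ∧
  ∀ f : E,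
    (∃ P P' : F, Selectable prec D P ∧ Selectable prec D P' ∧ f ∈ P.1 ∧ f ∉ P'.1) →
      (∃ Q : F, Selectable prec D Q ∧ f ∉ Q.1 ∧ Selectable prec (D.fix f (D.low f)) Q) ∧
      (∃ Q : F, Selectable prec D Q ∧ f ∈ Q.1 ∧ Selectable prec (D.fix f (D.high f)) Q)

/-- `f` can be asked for her lowest type: `f` is not yet revealed, belongs to some selectable
solution, and all selectable solutions avoiding `f` cease to be selectable if her type is the
lowest one. -/
def AscendingPick (prec : F → F → Prop) (D : TypeDomain E) (f : E) : Prop :=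
  1 < (D.vals f).card ∧ (∃ P : F, Selectable prec D P ∧ f ∈ P.1) ∧
  ∀ P : F, Selectable prec D P → f ∉ P.1 → ¬ Selectable prec (D.fix f (D.low f)) P

/-- `f` can be asked for her highest type: the mirror condition. -/
def DescendingPick (prec : F → F → Prop) (D : TypeDomain E) (f : E) : Prop :=
  1 < (D.vals f).card ∧ (∃ P : F, Selectable prec D P ∧ f ∈ P.1) ∧
  ∀ P : F, Selectable prec D P → f ∈ P.1 → ¬ Selectable prec (D.fix f (D.high f)) P

/-- `AlgorithmM prec D T`: the tree `T` is the tree of queries of the algorithm started at the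
current domain `D`, for some admissible choice of the agent at every query. The candidates are
always the solutions selectable for the current domain. After the answer "yes" to a query for
type `t` the domain of `f` becomes `{t}`, after "no" the type `t` is removed from it. -/
inductive AlgorithmM (prec : F → F → Prop) : TypeDomain E → ImplTree E F → Prop
  /-- Only one candidate is left: return it. -/
  | finish (D : TypeDomain E) (P : F) (hP : Selectable prec D P)
      (huniq : ∀ Q : F, Selectable prec D Q → Q = P) :
      AlgorithmM prec D (.leaf P)
  /-- Some candidate is not strongly selectable and an ascending query is possible. -/
  | mixedLow (D Dno : TypeDomain E) (f : E) (Tyes Tno : ImplTree E F)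
      (hmix : ∃ P : F, Selectable prec D P ∧ ¬ StronglySelectable prec D P)
      (hf : AscendingPick prec D f)
      (hyes : AlgorithmM prec (D.fix f (D.low f)) Tyes)
      (hDno : Dno.vals = Function.update D.vals f ((D.vals f).erase (D.low f)))
      (hno : AlgorithmM prec Dno Tno) :
      AlgorithmM prec D (.ask f (D.low f) Tyes Tno)
  /-- Some candidate is not strongly selectable and no ascending query is possible. -/
  | mixedHigh (D Dno : TypeDomain E) (f : E) (Tyes Tno : ImplTree E F)
      (hmix : ∃ P : F, Selectable prec D P ∧ ¬ StronglySelectable prec D P)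
      (hlow : ¬ ∃ g : E, AscendingPick prec D g)
      (hf : DescendingPick prec D f)
      (hyes : AlgorithmM prec (D.fix f (D.high f)) Tyes)
      (hDno : Dno.vals = Function.update D.vals f ((D.vals f).erase (D.high f)))
      (hno : AlgorithmM prec Dno Tno) :
      AlgorithmM prec D (.ask f (D.high f) Tyes Tno)
  /-- At least two candidates, all of them strongly selectable: an ascending query. -/
  | strong (D Dno : TypeDomain E) (f : E) (Tyes Tno : ImplTree E F)
      (htwo : {P : F | Selectable prec D P}.Nontrivial)
      (hall : ∀ P : F, Selectable prec D P → StronglySelectable prec D P)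
      (hf : AscendingPick prec D f)
      (hyes : AlgorithmM prec (D.fix f (D.low f)) Tyes)
      (hDno : Dno.vals = Function.update D.vals f ((D.vals f).erase (D.low f)))
      (hno : AlgorithmM prec Dno Tno) :
      AlgorithmM prec D (.ask f (D.low f) Tyes Tno)

end SetSystem

/-! Payments can be eliminated. The incentive constraints of two diverging profiles add up to
monotonicity of selection (`OSPFrom.monotoneFrom`), and on three values paying the middle one on
selection reverses this (`MonotoneFrom.ospFrom`). What remains is whether a monotone query tree can
compute the optimum. Selectable solutions are exactly those that are optimal at some profile of the
domain, so both conditions speak about this optimum function.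

Necessity: a monotone tree for `D` serves every subdomain. From an obstructed subdomain one descends
along an edge that preserves the obstruction. If the queried agent is avoided at some profile with
her lowest type and selected at some profile with her highest, her query separates nothing
(`MonotoneFrom.act_eq`). Otherwise only one end of her type range matters, and the edge keeping that
end is followed. The descent reaches a leaf, whose single solution would have to equal two different
optima.

Sufficiency: where neither obstruction holds and several candidates remain, an admissible pick
exists. Every answer shrinks the domain, so the recursion ends. The queries are monotone because an
ascending pick is always selected at her lowest type and a descending pick never at her highest. -/

namespace TypeDomain

/-! ### Subdomains, extreme types and extremal profiles -/

theorem IsSubdomain.refl {E : Type*} (D : TypeDomain E) : D.IsSubdomain D := fun _ => subset_rfl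

theorem IsSubdomain.trans {E : Type*} {D₁ D₂ D₃ : TypeDomain E} (h : D₁.IsSubdomain D₂)
    (h' : D₂.IsSubdomain D₃) : D₁.IsSubdomain D₃ := fun e => (h e).trans (h' e)

theorem IsSubdomain.profiles_subset {E : Type*} {D D' : TypeDomain E} (h : D'.IsSubdomain D) :
    D'.profiles ⊆ D.profiles := fun _ hb e => h e (hb e)

theorem low_mem {E : Type*} (D : TypeDomain E) (e : E) : D.low e ∈ D.vals e :=
  Finset.min'_mem _ _

theorem high_mem {E : Type*} (D : TypeDomain E) (e : E) : D.high e ∈ D.vals e :=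
  Finset.max'_mem _ _

theorem low_le {E : Type*} (D : TypeDomain E) {e : E} {t : ℝ} (h : t ∈ D.vals e) :
    D.low e ≤ t :=
  Finset.min'_le _ _ h

theorem le_high {E : Type*} (D : TypeDomain E) {e : E} {t : ℝ} (h : t ∈ D.vals e) :
    t ≤ D.high e :=
  Finset.le_max' _ _ h

theorem low_le_high {E : Type*} (D : TypeDomain E) (e : E) : D.low e ≤ D.high e :=
  D.le_high (D.low_mem e)

theorem IsSubdomain.low_le_low {E : Type*} {D D' : TypeDomain E} (h : D'.IsSubdomain D) (e : E) :
    D.low e ≤ D'.low e :=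
  D.low_le (h e (D'.low_mem e))

theorem IsSubdomain.high_le_high {E : Type*} {D D' : TypeDomain E} (h : D'.IsSubdomain D)
    (e : E) : D'.high e ≤ D.high e :=
  D.le_high (h e (D'.high_mem e))

theorem low_congr {E : Type*} {D D' : TypeDomain E} {e : E} (h : D'.vals e = D.vals e) :
    D'.low e = D.low e := by
  simp only [low, h]

theorem high_congr {E : Type*} {D D' : TypeDomain E} {e : E} (h : D'.vals e = D.vals e) :
    D'.high e = D.high e := by
  simp only [high, h]

theorem high_eq_low_of_card_le_one {E : Type*} (D : TypeDomain E) {e : E}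
    (h : (D.vals e).card ≤ 1) : D.high e = D.low e :=
  Finset.card_le_one.1 h _ (D.high_mem e) _ (D.low_mem e)

theorem fix_vals_self {E : Type*} [DecidableEq E] (D : TypeDomain E) (f : E) (t : ℝ) :
    (D.fix f t).vals f = {t} := by
  simp [fix]

theorem fix_vals_of_ne {E : Type*} [DecidableEq E] (D : TypeDomain E) {e f : E} (h : e ≠ f)
    (t : ℝ) : (D.fix f t).vals e = D.vals e := by
  simp [fix, h]

theorem fix_low_self {E : Type*} [DecidableEq E] (D : TypeDomain E) (f : E) (t : ℝ) :
    (D.fix f t).low f = t := by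
  simpa [fix_vals_self] using (D.fix f t).low_mem f

theorem fix_high_self {E : Type*} [DecidableEq E] (D : TypeDomain E) (f : E) (t : ℝ) :
    (D.fix f t).high f = t := by
  simpa [fix_vals_self] using (D.fix f t).high_mem f

theorem fix_low_of_ne {E : Type*} [DecidableEq E] (D : TypeDomain E) {e f : E} (h : e ≠ f)
    (t : ℝ) : (D.fix f t).low e = D.low e :=
  low_congr (D.fix_vals_of_ne h t)

theorem fix_high_of_ne {E : Type*} [DecidableEq E] (D : TypeDomain E) {e f : E} (h : e ≠ f)
    (t : ℝ) : (D.fix f t).high e = D.high e :=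
  high_congr (D.fix_vals_of_ne h t)

theorem fix_isSubdomain {E : Type*} [DecidableEq E] (D : TypeDomain E) {f : E} {t : ℝ}
    (ht : t ∈ D.vals f) : (D.fix f t).IsSubdomain D := by
  intro e
  by_cases h : e = f
  · subst h; simpa [fix_vals_self] using ht
  · rw [fix_vals_of_ne D h]

theorem fix_eq_self {E : Type*} [DecidableEq E] (D : TypeDomain E) {f : E} {t : ℝ}
    (ht : t ∈ D.vals f) (hc : (D.vals f).card ≤ 1) : D.fix f t = D := by
  ext1
  funext e
  by_cases h : e = f
  · subst h
    rw [fix_vals_self]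
    exact (Finset.eq_singleton_iff_unique_mem.2
      ⟨ht, fun x hx => Finset.card_le_one.1 hc _ hx _ ht⟩).symm
  · rw [fix_vals_of_ne D h]

/-- The subdomain where the types of `f` are replaced by the nonempty set `s`. -/
def replace {E : Type*} [DecidableEq E] (D : TypeDomain E) (f : E) (s : Finset ℝ)
    (hs : s.Nonempty) : TypeDomain E where
  vals := Function.update D.vals f s
  nonempty := by
    intro e
    by_cases h : e = f
    · subst h; simpa using hs
    · simpa [Function.update_of_ne h] using D.nonempty e

theorem replace_vals_self {E : Type*} [DecidableEq E] (D : TypeDomain E) (f : E) (s : Finset ℝ)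
    (hs : s.Nonempty) : (D.replace f s hs).vals f = s := by
  simp [replace]

theorem replace_vals_of_ne {E : Type*} [DecidableEq E] (D : TypeDomain E) {e f : E} (h : e ≠ f)
    (s : Finset ℝ) (hs : s.Nonempty) : (D.replace f s hs).vals e = D.vals e := by
  simp [replace, h]

theorem replace_isSubdomain {E : Type*} [DecidableEq E] (D : TypeDomain E) {f : E}
    {s : Finset ℝ} (hs : s.Nonempty) (h : s ⊆ D.vals f) :
    (D.replace f s hs).IsSubdomain D := by
  intro e
  by_cases he : e = f
  · subst he; rwa [replace_vals_self]
  · rw [replace_vals_of_ne D he]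

theorem mem_profiles_update {E : Type*} [DecidableEq E] {D : TypeDomain E} {b : E → ℝ}
    (hb : b ∈ D.profiles) {f : E} {t : ℝ} (ht : t ∈ D.vals f) :
    Function.update b f t ∈ D.profiles := by
  intro e
  by_cases h : e = f
  · subst h; simpa using ht
  · simpa [h] using hb e

/-- The profile where the members of `P` have their lowest and all others their highest type. -/
noncomputable def extremal {E : Type*} [DecidableEq E] (D : TypeDomain E) (P : Finset E) :
    E → ℝ :=
  fun e => if e ∈ P then D.low e else D.high e

theorem extremal_mem {E : Type*} [DecidableEq E] (D : TypeDomain E) (P : Finset E) :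
    D.extremal P ∈ D.profiles := by
  intro e
  by_cases h : e ∈ P
  · simpa [extremal, h] using D.low_mem e
  · simpa [extremal, h] using D.high_mem e

/-- The subdomain of the types of `f` that are sent to `j` by `act`, with its profiles. -/
theorem exists_subdomain_of_action {E : Type*} [DecidableEq E] (D : TypeDomain E) (f : E) {k : ℕ}
    (act : ℝ → Fin k) {t : ℝ} (ht : t ∈ D.vals f) :
    ∃ D' : TypeDomain E, D'.IsSubdomain D ∧ (∀ e, e ≠ f → D'.vals e = D.vals e) ∧
      t ∈ D'.vals f ∧ ((∀ s ∈ D.vals f, act s = act t) → D' = D) ∧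
      {b ∈ D.profiles | act (b f) = act t} = D'.profiles := by
  have hs : ((D.vals f).filter fun s => act s = act t).Nonempty := ⟨t, by simp [ht]⟩
  refine ⟨D.replace f _ hs, D.replace_isSubdomain hs (Finset.filter_subset _ _),
    fun e he => D.replace_vals_of_ne he _ hs, by simp [replace_vals_self, ht], fun h => ?_, ?_⟩
  · ext1
    funext e
    by_cases he : e = f
    · subst he; rw [replace_vals_self, Finset.filter_true_of_mem h]
    · rw [replace_vals_of_ne D he]
  · ext b
    constructor
    · rintro ⟨hb, ha⟩ e
      by_cases he : e = f
      · subst he; rw [replace_vals_self]; exact Finset.mem_filter.2 ⟨hb e, ha⟩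
      · rw [replace_vals_of_ne D he]; exact hb e
    · intro hb
      refine ⟨(D.replace_isSubdomain hs (Finset.filter_subset _ _)).profiles_subset hb, ?_⟩
      have := hb f
      rw [replace_vals_self] at this
      exact (Finset.mem_filter.1 this).2

end TypeDomain

/-! ### Relabelling the leaves of a tree -/

namespace ImplTree

theorem run_map {E O O' : Type*} (g : O → O') (T : ImplTree E O) (b : E → ℝ) :
    (T.map g).run b = g (T.run b) := by
  induction T with
  | leaf x => rfl
  | node i k act child ih => exact ih _

theorem map_map_of_leftInverse {E O O' : Type*} {g : O → O'} {g' : O' → O}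
    (h : Function.LeftInverse g' g) (T : ImplTree E O) : (T.map g).map g' = T := by
  induction T with
  | leaf x => simp [map, h x]
  | node i k act child ih => simp [map, ih]

end ImplTree

namespace SetSystem

/-! ### Optima and selectability -/

section Optimum

variable {E : Type*} [DecidableEq E] {F : Finset (Finset E)} {prec : F → F → Prop}

/-- The common members contribute equally to both costs; cancelling them gives the shape in which
`Selectable` is defined. -/
theorem isOptimum_iff_sdiff {b : E → ℝ} {P : F} :
    IsOptimum prec b P ↔ ∀ Q : F, Q ≠ P →
      ∑ e ∈ P.1 \ Q.1, b e < ∑ e ∈ Q.1 \ P.1, b e ∨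
        (∑ e ∈ P.1 \ Q.1, b e = ∑ e ∈ Q.1 \ P.1, b e ∧ prec P Q) := by
  refine forall₂_congr fun Q _ => ?_
  have h := Finset.sum_sdiff_sub_sum_sdiff (s₁ := P.1) (s₂ := Q.1) (f := b)
  refine or_congr ?_ (and_congr_left fun _ => ?_)
  · constructor <;> intro _ <;> linarith
  · constructor <;> intro _ <;> linarith

theorem IsOptimum.unique [IsStrictTotalOrder F prec] {b : E → ℝ} {P Q : F}
    (hP : IsOptimum prec b P) (hQ : IsOptimum prec b Q) : P = Q := by
  by_contra hne
  rcases hP Q (Ne.symm hne) with h | ⟨h, hp⟩ <;> rcases hQ P hne with h' | ⟨h', hp'⟩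
  · linarith
  · linarith
  · linarith
  · exact asymm_of prec hp hp'

theorem exists_isOptimum {E : Type*} {F : Finset (Finset E)} {prec : F → F → Prop}
    [IsStrictTotalOrder F prec] (hF : F.Nonempty) (b : E → ℝ) :
    ∃ P : F, IsOptimum prec b P := by
  -- Cost first, then `prec`: a transitive irreflexive relation on a finite type, hence one with a
  -- minimal element.
  let R : F → F → Prop := fun P Q =>
    ∑ e ∈ P.1, b e < ∑ e ∈ Q.1, b e ∨ (∑ e ∈ P.1, b e = ∑ e ∈ Q.1, b e ∧ prec P Q)
  have : IsTrans F R := ⟨by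
    rintro P Q S (h | ⟨h, hp⟩) (h' | ⟨h', hp'⟩)
    · exact .inl (h.trans h')
    · exact .inl (h' ▸ h)
    · exact .inl (h ▸ h')
    · exact .inr ⟨h.trans h', trans_of prec hp hp'⟩⟩
  have : Std.Irrefl R := ⟨by
    rintro P (h | ⟨_, hp⟩)
    · exact lt_irrefl _ h
    · exact irrefl_of prec P hp⟩
  obtain ⟨P, -, hP⟩ := (Finite.wellFounded_of_trans_of_irrefl R).has_min Set.univ
    ⟨⟨hF.choose, hF.choose_spec⟩, trivial⟩
  refine ⟨P, fun Q hQ => ?_⟩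
  have hn := hP Q trivial
  rcases lt_trichotomy (∑ e ∈ P.1, b e) (∑ e ∈ Q.1, b e) with h | h | h
  · exact .inl h
  · rcases trichotomous_of prec P Q with hp | hp | hp
    · exact .inr ⟨h, hp⟩
    · exact absurd hp.symm hQ
    · exact absurd (.inr ⟨h.symm, hp⟩) hn
  · exact absurd (.inl h) hn

/-- A solution is selectable if and only if it is the optimum at the profile that favours it
most. -/
theorem selectable_iff_isOptimum_extremal {D : TypeDomain E} {P : F} :
    Selectable prec D P ↔ IsOptimum prec (D.extremal P.1) P := by
  rw [isOptimum_iff_sdiff]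
  refine forall₂_congr fun Q _ => ?_
  have h₁ : ∑ e ∈ P.1 \ Q.1, D.extremal P.1 e = D.lowCost (P.1 \ Q.1) :=
    Finset.sum_congr rfl fun e he => by simp [TypeDomain.extremal, (Finset.mem_sdiff.1 he).1]
  have h₂ : ∑ e ∈ Q.1 \ P.1, D.extremal P.1 e = D.highCost (Q.1 \ P.1) :=
    Finset.sum_congr rfl fun e he => by simp [TypeDomain.extremal, (Finset.mem_sdiff.1 he).2]
  rw [h₁, h₂]

/-- Making members cheaper and outsiders dearer improves `P` in every comparison. All monotonicity
of selectability in the domain comes from here. -/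
theorem IsOptimum.of_le {b c : E → ℝ} {P : F} (h : IsOptimum prec b P)
    (hlow : ∀ e ∈ P.1, c e ≤ b e) (hhigh : ∀ e ∉ P.1, b e ≤ c e) : IsOptimum prec c P := by
  rw [isOptimum_iff_sdiff] at h ⊢
  intro Q hQ
  have h₁ : ∑ e ∈ P.1 \ Q.1, c e ≤ ∑ e ∈ P.1 \ Q.1, b e :=
    Finset.sum_le_sum fun e he => hlow e (Finset.mem_sdiff.1 he).1
  have h₂ : ∑ e ∈ Q.1 \ P.1, b e ≤ ∑ e ∈ Q.1 \ P.1, c e :=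
    Finset.sum_le_sum fun e he => hhigh e (Finset.mem_sdiff.1 he).2
  rcases h Q hQ with h | ⟨h, hp⟩
  · exact .inl (by linarith)
  · rcases (h₁.trans (h.trans_le h₂)).lt_or_eq with h' | h'
    · exact .inl h'
    · exact .inr ⟨h', hp⟩

theorem IsOptimum.selectable {D : TypeDomain E} {b : E → ℝ} {P : F} (h : IsOptimum prec b P)
    (hb : b ∈ D.profiles) : Selectable prec D P :=
  selectable_iff_isOptimum_extremal.2 <| h.of_le
    (fun e he => by simpa [TypeDomain.extremal, he] using D.low_le (hb e))
    (fun e he => by simpa [TypeDomain.extremal, he] using D.le_high (hb e))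

theorem Selectable.of_le {D D' : TypeDomain E} {P : F} (h : Selectable prec D P)
    (hlow : ∀ e ∈ P.1, D'.low e ≤ D.low e) (hhigh : ∀ e ∉ P.1, D.high e ≤ D'.high e) :
    Selectable prec D' P :=
  selectable_iff_isOptimum_extremal.2 <| (selectable_iff_isOptimum_extremal.1 h).of_le
    (fun e he => by simpa [TypeDomain.extremal, he] using hlow e he)
    (fun e he => by simpa [TypeDomain.extremal, he] using hhigh e he)

theorem Selectable.of_isSubdomain {D D' : TypeDomain E} (h : D'.IsSubdomain D) {P : F}
    (hP : Selectable prec D' P) : Selectable prec D P :=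
  hP.of_le (fun e _ => h.low_le_low e) (fun e _ => h.high_le_high e)

/-- A solution that is selectable once `f` has type `t` is the optimum at a profile where `f` has
type `t`. -/
theorem Selectable.exists_profile {D : TypeDomain E} {P : F} {f : E} {t : ℝ}
    (ht : t ∈ D.vals f) (h : Selectable prec (D.fix f t) P) :
    ∃ b ∈ D.profiles, b f = t ∧ IsOptimum prec b P := by
  have hb := (D.fix f t).extremal_mem P.1
  refine ⟨_, (D.fix_isSubdomain ht).profiles_subset hb, ?_,
    selectable_iff_isOptimum_extremal.1 h⟩
  have := hb f
  rwa [D.fix_vals_self, Finset.mem_singleton] at this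

theorem IsOptimum.selectable_fix {D : TypeDomain E} {b : E → ℝ} {P : F}
    (h : IsOptimum prec b P) (hb : b ∈ D.profiles) (f : E) :
    Selectable prec (D.fix f (b f)) P := by
  refine h.selectable fun e => ?_
  by_cases he : e = f
  · subst he; simp [D.fix_vals_self]
  · rw [D.fix_vals_of_ne he]; exact hb e

/-- Two distinct solutions cannot both be selectable if all their members are revealed. -/
theorem Selectable.eq_of_card_le_one [IsStrictTotalOrder F prec] {D : TypeDomain E} {P Q : F}
    (hP : Selectable prec D P) (hQ : Selectable prec D Q)
    (hP1 : ∀ e ∈ P.1, (D.vals e).card ≤ 1) (hQ1 : ∀ e ∈ Q.1, (D.vals e).card ≤ 1) : P = Q := by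
  by_contra hne
  -- Highest and lowest costs of the two differences coincide, so the two selectability conditions
  -- contradict each other.
  have key : ∀ R R' : F, (∀ e ∈ R.1, (D.vals e).card ≤ 1) →
      D.highCost (R.1 \ R'.1) = D.lowCost (R.1 \ R'.1) := fun R R' h =>
    Finset.sum_congr rfl fun e he =>
      D.high_eq_low_of_card_le_one (h e (Finset.mem_sdiff.1 he).1)
  have h₁ := hP Q (Ne.symm hne)
  have h₂ := hQ P hne
  rw [key Q P hQ1] at h₁
  rw [key P Q hP1] at h₂
  rcases h₁ with h | ⟨h, hp⟩ <;> rcases h₂ with h' | ⟨h', hp'⟩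
  · linarith
  · linarith
  · linarith
  · exact asymm_of prec hp hp'

end Optimum

/-! ### Monotone trees and payments -/

section Monotone

variable {E : Type*} [DecidableEq E] {F : Finset (Finset E)} {prec : F → F → Prop}

/-- Monotonicity at all vertices of a (sub)tree with `X` as the set of profiles compatible with
its root: among two profiles that diverge at a vertex, the queried agent is selected at the one
where her cost is lower whenever she is selected at the other one. -/
def MonotoneFrom : ImplTree E F → Set (E → ℝ) → Prop
  | .leaf _, _ => True
  | .node i k act child, X =>
      (∀ b ∈ X, ∀ b' ∈ X, act (b i) ≠ act (b' i) → b i < b' i →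
        i ∈ ((ImplTree.node i k act child).run b').1 →
          i ∈ ((ImplTree.node i k act child).run b).1) ∧
      ∀ j, MonotoneFrom (child j) {b ∈ X | act (b i) = j}

theorem MonotoneFrom.mono {E : Type*} {F : Finset (Finset E)} {T : ImplTree E F}
    {X Y : Set (E → ℝ)} (h : MonotoneFrom T X) (hY : Y ⊆ X) : MonotoneFrom T Y := by
  induction T generalizing X Y with
  | leaf x => trivial
  | node i k act child ih =>
    exact ⟨fun b hb b' hb' => h.1 b (hY hb) b' (hY hb'),
      fun j => ih j (h.2 j) fun b hb => ⟨hY hb.1, hb.2⟩⟩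

/-- If the agent were selected only at the dearer profile, her two incentive constraints, once
added, would lose the payments and force `b' i ≤ b i`. -/
theorem OSPFrom.monotoneFrom {M : Mechanism F} {X : Set (E → ℝ)} (h : OSPFrom M X) :
    MonotoneFrom (M.map Prod.fst) X := by
  induction M generalizing X with
  | leaf x => trivial
  | node i k act child ih =>
    refine ⟨fun b hb b' hb' hne hlt hmem => ?_, fun j => ih j (h.2 j)⟩
    have h₁ := h.1 b hb b' hb' hne
    have h₂ := h.1 b' hb' b hb hne.symm
    change i ∈ (((ImplTree.node i k act child).map Prod.fst).run b').1 at hmem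
    change i ∈ (((ImplTree.node i k act child).map Prod.fst).run b).1
    rw [ImplTree.run_map] at hmem ⊢
    by_contra hn
    simp only [utility, hmem, hn, if_true, if_false] at h₁ h₂
    linarith

/-- If all types of an agent are among three values, paying her the middle one whenever she is
selected turns a monotone tree into an obviously strategyproof mechanism. -/
theorem MonotoneFrom.ospFrom {T : ImplTree E F} {X : Set (E → ℝ)} (h : MonotoneFrom T X)
    {mid : E → ℝ} (hX : ∀ b ∈ X, ∀ b' ∈ X, ∀ e,
      (b e < mid e → b' e ≠ b e → b e < b' e) ∧ (mid e < b e → b' e ≠ b e → b' e < b e)) :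
    OSPFrom (T.map fun P => (P, fun e => if e ∈ P.1 then mid e else 0)) X := by
  induction T generalizing X with
  | leaf x => trivial
  | node i k act child ih =>
    refine ⟨fun b hb b' hb' hne => ?_,
      fun j => ih j (h.2 j) fun b hb b' hb' => hX b hb.1 b' hb'.1⟩
    change utility i (b i) (((ImplTree.node i k act child).map _).run b') ≤
      utility i (b i) (((ImplTree.node i k act child).map _).run b)
    rw [ImplTree.run_map, ImplTree.run_map]
    have hne' : b' i ≠ b i := fun heq => hne (by rw [heq])
    have h₁ := h.1 b hb b' hb' hne
    have h₂ := h.1 b' hb' b hb hne.symm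
    obtain ⟨hlo, hhi⟩ := hX b hb b' hb' i
    by_cases m : i ∈ ((ImplTree.node i k act child).run b).1 <;>
      by_cases m' : i ∈ ((ImplTree.node i k act child).run b').1
    · simp [utility, m, m']
    -- A type above the middle is the top type, so being selected at it forces selection at `b'`
    -- too. Hence truthful selection never yields a loss; the next case is the mirror image.
    · have : b i ≤ mid i := not_lt.1 fun hc => m' (h₂ (hhi hc hne') m)
      simpa [utility, m, m'] using this
    · have : mid i ≤ b i := not_lt.1 fun hc => m (h₁ (hlo hc hne') m')
      simpa [utility, m, m'] using this
    · simp [utility, m, m']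

/-- The three-value assumption enters here: a type below the middle value is below all other types,
and a type above it is above all others. -/
theorem MonotoneFrom.exists_mechanism {T : ImplTree E F} {D : TypeDomain E}
    (h : MonotoneFrom T D.profiles) (hopt : ∀ b ∈ D.profiles, IsOptimum prec b (T.run b))
    (hD : ∀ e, ∃ l m h : ℝ, l < m ∧ m < h ∧ D.vals e ⊆ {l, m, h}) :
    ∃ M : Mechanism F, M.map Prod.fst = T ∧ IsOSP D M ∧ IsOptimal prec D M := by
  choose l mid u hl hu hD using hD
  refine ⟨_, ImplTree.map_map_of_leftInverse (fun _ => rfl) T, h.ospFrom (mid := mid) ?_,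
    fun b hb => ?_⟩
  · intro b hb b' hb' e
    have h₁ := hD e (hb e)
    have h₂ := hD e (hb' e)
    have := hl e
    have := hu e
    simp only [Finset.mem_insert, Finset.mem_singleton] at h₁ h₂
    constructor <;> intro hc hne <;>
      rcases h₁ with h₁ | h₁ | h₁ <;> rcases h₂ with h₂ | h₂ | h₂ <;>
      first
        | exact absurd (h₂.trans h₁.symm) hne
        | linarith
  · rw [ImplTree.run_map]
    exact hopt b hb

/-- If a queried agent is not always selected at her lowest type and sometimes selected at her
highest type, a monotone query of her cannot separate any of her types. -/
theorem MonotoneFrom.act_eq {D : TypeDomain E} {f : E} {k : ℕ} {act : ℝ → Fin k}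
    {child : Fin k → ImplTree E F} (h : MonotoneFrom (.node f k act child) D.profiles)
    {b b' : E → ℝ} (hb : b ∈ D.profiles) (hb' : b' ∈ D.profiles) (hlow : b f = D.low f)
    (hhigh : b' f = D.high f) (hn : f ∉ ((ImplTree.node f k act child).run b).1)
    (hm : f ∈ ((ImplTree.node f k act child).run b').1) {t : ℝ} (ht : t ∈ D.vals f) :
    act t = act (D.high f) := by
  have hlt : ∀ {s s' : ℝ}, s ≤ s' → act s ≠ act s' → s < s' :=
    fun hle hne => hle.lt_of_ne fun heq => hne (by rw [heq])
  have hlh : act (D.low f) = act (D.high f) := by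
    by_contra hne
    refine hn (h.1 b hb b' hb' ?_ ?_ hm)
    · rwa [hlow, hhigh]
    · rw [hlow, hhigh]; exact hlt (D.low_le_high f) hne
  by_contra hne
  -- A type separated from both extremes is an intermediate stop: selection passes from `b'` to the
  -- updated profile and from there to `b`.
  have hc := TypeDomain.mem_profiles_update hb ht
  have hcf : Function.update b f t f = t := by simp
  refine hn (h.1 b hb _ hc ?_ ?_ (h.1 _ hc b' hb' ?_ ?_ hm))
  · rw [hlow, hcf, hlh]; exact Ne.symm hne
  · rw [hlow, hcf]; exact hlt (D.low_le ht) (by rw [hlh]; exact Ne.symm hne)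
  · rwa [hcf, hhigh]
  · rw [hcf, hhigh]; exact hlt (D.le_high ht) hne

end Monotone

/-! ### Necessity: obstructions exclude monotone trees -/

section Obstruction

variable {E : Type*} [DecidableEq E] {F : Finset (Finset E)} {prec : F → F → Prop}

theorem StronglySelectable.of_isSubdomain {D D' : TypeDomain E} (h : D'.IsSubdomain D)
    (hhigh : ∀ e, D'.high e = D.high e) {P : F} (hP : StronglySelectable prec D' P) :
    StronglySelectable prec D P := by
  refine ⟨hP.1.of_isSubdomain h, fun e he => (hP.2 e he).of_isSubdomain fun g => ?_⟩
  by_cases hg : g = e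
  · subst hg; rw [TypeDomain.fix_vals_self, TypeDomain.fix_vals_self, hhigh]
  · rw [TypeDomain.fix_vals_of_ne _ hg, TypeDomain.fix_vals_of_ne _ hg]; exact h g

/-- Selectability with the type of `g` fixed only depends on the lowest types of the members and
the highest types of the other agents. -/
theorem Selectable.fix_congr {D D' : TypeDomain E} {P : F} {g : E} {t : ℝ}
    (h : Selectable prec (D.fix g t) P)
    (hlow : ∀ e ∈ P.1, D'.low e = D.low e) (hhigh : ∀ e ∉ P.1, D'.high e = D.high e) :
    Selectable prec (D'.fix g t) P := by
  refine h.of_le (fun e he => ?_) (fun e he => ?_)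
  · by_cases hg : e = g
    · subst hg; rw [TypeDomain.fix_low_self, TypeDomain.fix_low_self]
    · rw [TypeDomain.fix_low_of_ne _ hg, TypeDomain.fix_low_of_ne _ hg, hlow e he]
  · by_cases hg : e = g
    · subst hg; rw [TypeDomain.fix_high_self, TypeDomain.fix_high_self]
    · rw [TypeDomain.fix_high_of_ne _ hg, TypeDomain.fix_high_of_ne _ hg, hhigh e he]

/-- An agent outside all strongly selectable solutions affects them only through her highest type,
so her other types can be dropped. -/
theorem ObstructionOne.of_isSubdomain {D D' : TypeDomain E} {f : E} (hO : ObstructionOne prec D)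
    (hsub : D'.IsSubdomain D) (hne : ∀ e, e ≠ f → D'.vals e = D.vals e)
    (hhigh : D'.high f = D.high f) (hf : ∀ P : F, StronglySelectable prec D P → f ∉ P.1) :
    ObstructionOne prec D' := by
  have hh : ∀ e, D'.high e = D.high e := fun e => by
    by_cases he : e = f
    · rw [he, hhigh]
    · exact TypeDomain.high_congr (hne e he)
  have hl : ∀ P : F, StronglySelectable prec D P → ∀ e ∈ P.1, D'.low e = D.low e :=
    fun P hP e he => TypeDomain.low_congr (hne e fun hef => hf P hP (hef ▸ he))
  have hss : ∀ P : F, StronglySelectable prec D P → StronglySelectable prec D' P :=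
    fun P hP => ⟨hP.1.of_le (fun e he => (hl P hP e he).le) (fun e _ => (hh e).ge),
      fun e he => by
        rw [hh]; exact (hP.2 e he).fix_congr (hl P hP) fun e _ => hh e⟩
  obtain ⟨⟨P, hP, g, hg, hc⟩, h⟩ := hO
  refine ⟨⟨P, hss P hP, g, hg, ?_⟩, fun P hP' g hg hc => ?_⟩
  · rwa [hne g fun hgf => hf P hP (hgf ▸ hg)]
  · have hP := hP'.of_isSubdomain hsub hh
    have hgf : g ≠ f := fun hgf => hf P hP (hgf ▸ hg)
    rw [hne g hgf] at hc
    obtain ⟨Q, hQ, hgQ, hs⟩ := h P hP g hg hc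
    refine ⟨Q, hss Q hQ, hgQ, ?_⟩
    rw [TypeDomain.low_congr (hne g hgf)]
    exact hs.fix_congr (hl Q hQ) fun e _ => hh e

/-- The first obstruction excludes monotone trees that return the optimum. -/
theorem MonotoneFrom.not_obstructionOne [IsStrictTotalOrder F prec] {T : ImplTree E F}
    {D : TypeDomain E} (h : MonotoneFrom T D.profiles)
    (hopt : ∀ b ∈ D.profiles, IsOptimum prec b (T.run b)) : ¬ ObstructionOne prec D := by
  induction T generalizing D with
  | leaf x =>
    rintro ⟨⟨P, hP, g, hg, hc⟩, hO⟩
    obtain ⟨Q, hQ, hgQ, -⟩ := hO P hP g hg hc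
    have h₁ := (hopt _ (D.extremal_mem P.1)).unique (selectable_iff_isOptimum_extremal.1 hP.1)
    have h₂ := (hopt _ (D.extremal_mem Q.1)).unique (selectable_iff_isOptimum_extremal.1 hQ.1)
    change x = P at h₁
    change x = Q at h₂
    exact hgQ (h₂ ▸ h₁ ▸ hg)
  | node f k act child ih =>
    intro hO
    -- The edge taken by the highest type of `f` is followed: strong selectability needs that type
    -- to stay available.
    obtain ⟨D', hsub, hne, hmem, hD', hprof⟩ :=
      D.exists_subdomain_of_action f act (D.high_mem f)
    have hno : ¬ ObstructionOne prec D' := by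
      refine ih (act (D.high f)) (hprof ▸ h.2 _) fun b hb => ?_
      obtain ⟨hb, ha⟩ := hprof.symm ▸ hb
      rw [← ha]
      exact hopt b hb
    by_cases hf : ∀ P : F, StronglySelectable prec D P → f ∉ P.1
    · exact hno (hO.of_isSubdomain hsub hne
        (le_antisymm (hsub.high_le_high f) (D'.le_high hmem)) hf)
    · push Not at hf
      obtain ⟨P, hP, hfP⟩ := hf
      refine hno ((hD' fun t ht => ?_) ▸ hO)
      by_cases hc : 1 < (D.vals f).card
      -- The exchange solution `Q` avoids `f` at her lowest type, while strong selectability keeps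
      -- `P` optimal at her highest. So the query is trivial and `D' = D`.
      · obtain ⟨Q, -, hfQ, hQ⟩ := hO.2 P hP f hfP hc
        obtain ⟨b, hb, hbf, hbQ⟩ := hQ.exists_profile (D.low_mem f)
        obtain ⟨b', hb', hbf', hbP⟩ := (hP.2 f hfP).exists_profile (D.high_mem f)
        refine h.act_eq hb hb' hbf hbf' ?_ ?_ ht
        · rwa [(hopt b hb).unique hbQ]
        · rwa [(hopt b' hb').unique hbP]
      · rw [Finset.card_le_one.1 (not_lt.1 hc) _ ht _ (D.high_mem f)]

/-- The second obstruction excludes monotone trees that return the optimum. It is enough to have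
two selectable solutions and the exchange property. -/
theorem MonotoneFrom.not_nontrivial_and_exchange [IsStrictTotalOrder F prec] {T : ImplTree E F}
    {D : TypeDomain E} (h : MonotoneFrom T D.profiles)
    (hopt : ∀ b ∈ D.profiles, IsOptimum prec b (T.run b))
    (hnt : {P : F | Selectable prec D P}.Nontrivial)
    (hex : ∀ f : E, (∃ P P' : F, Selectable prec D P ∧ Selectable prec D P' ∧ f ∈ P.1 ∧ f ∉ P'.1) →
      (∃ Q : F, Selectable prec D Q ∧ f ∉ Q.1 ∧ Selectable prec (D.fix f (D.low f)) Q) ∧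
      (∃ Q : F, Selectable prec D Q ∧ f ∈ Q.1 ∧ Selectable prec (D.fix f (D.high f)) Q)) :
    False := by
  induction T generalizing D with
  | leaf x =>
    obtain ⟨P, hP, Q, hQ, hPQ⟩ := hnt
    exact hPQ (((hopt _ (D.extremal_mem P.1)).unique
      (selectable_iff_isOptimum_extremal.1 hP)).symm.trans
      ((hopt _ (D.extremal_mem Q.1)).unique (selectable_iff_isOptimum_extremal.1 hQ)))
  | node f k act child ih =>
    have hchild : ∀ t, ∀ D' : TypeDomain E,
        {b ∈ D.profiles | act (b f) = act t} = D'.profiles →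
        MonotoneFrom (child (act t)) D'.profiles ∧
          ∀ b ∈ D'.profiles, IsOptimum prec b ((child (act t)).run b) := by
      intro t D' hprof
      refine ⟨hprof ▸ h.2 _, fun b hb => ?_⟩
      obtain ⟨hb, ha⟩ := hprof.symm ▸ hb
      rw [← ha]
      exact hopt b hb
    by_cases hf : ∃ P P' : F, Selectable prec D P ∧ Selectable prec D P' ∧ f ∈ P.1 ∧ f ∉ P'.1
    · obtain ⟨⟨Q, -, hfQ, hQ⟩, ⟨Q', -, hfQ', hQ'⟩⟩ := hex f hf
      obtain ⟨b, hb, hbf, hbQ⟩ := hQ.exists_profile (D.low_mem f)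
      obtain ⟨b', hb', hbf', hbQ'⟩ := hQ'.exists_profile (D.high_mem f)
      obtain ⟨D', -, -, -, hD', hprof⟩ := D.exists_subdomain_of_action f act (D.high_mem f)
      have hDD : D' = D := hD' fun t ht => h.act_eq hb hb' hbf hbf'
        (by rwa [(hopt b hb).unique hbQ]) (by rwa [(hopt b' hb').unique hbQ']) ht
      obtain ⟨hm, ho⟩ := hchild _ _ hprof
      subst hDD
      exact ih _ hm ho hnt hex
    -- Now `f` lies in all selectable solutions or in none. An edge keeping her lowest type in the
    -- first case, her highest in the second, preserves both hypotheses.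
    · have hpersist : ∀ t, ∀ D' : TypeDomain E, D'.IsSubdomain D →
          (∀ e, e ≠ f → D'.vals e = D.vals e) →
          {b ∈ D.profiles | act (b f) = act t} = D'.profiles →
          (∀ P : F, Selectable prec D P →
            (f ∈ P.1 → D'.low f = D.low f) ∧ (f ∉ P.1 → D'.high f = D.high f)) → False := by
        intro t D' hsub hne hprof hlh
        obtain ⟨hm, ho⟩ := hchild t D' hprof
        have hl : ∀ P : F, Selectable prec D P → ∀ e ∈ P.1, D'.low e = D.low e := by
          intro P hP e he
          by_cases hef : e = f
          · subst hef; exact (hlh P hP).1 he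
          · exact TypeDomain.low_congr (hne e hef)
        have hh : ∀ P : F, Selectable prec D P → ∀ e ∉ P.1, D'.high e = D.high e := by
          intro P hP e he
          by_cases hef : e = f
          · subst hef; exact (hlh P hP).2 he
          · exact TypeDomain.high_congr (hne e hef)
        have hS : ∀ P : F, Selectable prec D P → Selectable prec D' P := fun P hP =>
          hP.of_le (fun e he => (hl P hP e he).le) (fun e he => (hh P hP e he).ge)
        refine ih (act t) hm ho (hnt.mono hS) ?_
        rintro g ⟨P, P', hP, hP', hgP, hgP'⟩
        have hg : ∃ P P' : F, Selectable prec D P ∧ Selectable prec D P' ∧ g ∈ P.1 ∧ g ∉ P'.1 :=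
          ⟨P, P', hP.of_isSubdomain hsub, hP'.of_isSubdomain hsub, hgP, hgP'⟩
        -- Shrinking the domain creates no selectable solutions, so `f` still distinguishes none of
        -- them.
        have hgf : g ≠ f := fun hgf => hf (hgf ▸ hg)
        obtain ⟨⟨Q, hQ, hgQ, hQl⟩, ⟨Q', hQ', hgQ', hQh⟩⟩ := hex g hg
        rw [TypeDomain.low_congr (hne g hgf), TypeDomain.high_congr (hne g hgf)]
        exact ⟨⟨Q, hS Q hQ, hgQ, hQl.fix_congr (hl Q hQ) (hh Q hQ)⟩,
          ⟨Q', hS Q' hQ', hgQ', hQh.fix_congr (hl Q' hQ') (hh Q' hQ')⟩⟩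
      by_cases hall : ∃ P : F, Selectable prec D P ∧ f ∈ P.1
      · obtain ⟨D', hsub, hne, hmem, -, hprof⟩ :=
          D.exists_subdomain_of_action f act (D.low_mem f)
        obtain ⟨P₀, hP₀, hfP₀⟩ := hall
        exact hpersist _ D' hsub hne hprof fun P hP =>
          ⟨fun _ => le_antisymm (D'.low_le hmem) (hsub.low_le_low f),
            fun hfP => absurd ⟨P₀, P, hP₀, hP, hfP₀, hfP⟩ hf⟩
      · obtain ⟨D', hsub, hne, hmem, -, hprof⟩ :=
          D.exists_subdomain_of_action f act (D.high_mem f)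
        exact hpersist _ D' hsub hne hprof fun P hP =>
          ⟨fun hfP => absurd ⟨P, hP, hfP⟩ hall,
            fun _ => le_antisymm (hsub.high_le_high f) (D'.le_high hmem)⟩

theorem not_obstruction_of_mechanism [IsStrictTotalOrder F prec] {D D' : TypeDomain E}
    {M : Mechanism F} (hM : IsOSP D M) (hopt : IsOptimal prec D M) (hsub : D'.IsSubdomain D) :
    ¬ (ObstructionOne prec D' ∨ ObstructionTwo prec D') := by
  have hm : MonotoneFrom (M.map Prod.fst) D'.profiles :=
    (OSPFrom.monotoneFrom hM).mono hsub.profiles_subset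
  have ho : ∀ b ∈ D'.profiles, IsOptimum prec b ((M.map Prod.fst).run b) := fun b hb => by
    rw [ImplTree.run_map]
    exact hopt b (hsub.profiles_subset hb)
  rintro (h | h)
  · exact hm.not_obstructionOne ho h
  · exact hm.not_nontrivial_and_exchange ho h.1.1 h.2

end Obstruction

/-! ### Sufficiency: correctness and feasibility of the algorithm -/

section Algorithm

variable {E : Type*} [DecidableEq E] {F : Finset (Finset E)} {prec : F → F → Prop}

theorem run_ask {E O : Type*} (f : E) (t : ℝ) (Tyes Tno : ImplTree E O) (b : E → ℝ) :
    (ImplTree.ask f t Tyes Tno).run b = if b f = t then Tyes.run b else Tno.run b := by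
  by_cases h : b f = t <;> simp [ImplTree.ask, ImplTree.run, h]

theorem mem_profiles_fix {D : TypeDomain E} {f : E} {b : E → ℝ} (hb : b ∈ D.profiles) :
    b ∈ (D.fix f (b f)).profiles := by
  intro e
  by_cases he : e = f
  · subst he; simp [D.fix_vals_self]
  · rw [D.fix_vals_of_ne he]; exact hb e

theorem mem_profiles_erase {D D' : TypeDomain E} {f : E} {t : ℝ}
    (hD' : D'.vals = Function.update D.vals f ((D.vals f).erase t)) {b : E → ℝ}
    (hb : b ∈ D.profiles) (hbt : b f ≠ t) : b ∈ D'.profiles := by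
  intro e
  rw [hD']
  by_cases he : e = f
  · subst he; simpa [hbt] using hb e
  · simpa [he] using hb e

theorem isOptimum_run_ask {D D' : TypeDomain E} {f : E} {t : ℝ} {Tyes Tno : ImplTree E F}
    (hD' : D'.vals = Function.update D.vals f ((D.vals f).erase t))
    (hyes : ∀ b ∈ (D.fix f t).profiles, IsOptimum prec b (Tyes.run b))
    (hno : ∀ b ∈ D'.profiles, IsOptimum prec b (Tno.run b)) :
    ∀ b ∈ D.profiles, IsOptimum prec b ((ImplTree.ask f t Tyes Tno).run b) := by
  intro b hb
  rw [run_ask]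
  split_ifs with h
  · exact hyes b (h ▸ mem_profiles_fix hb)
  · exact hno b (mem_profiles_erase hD' hb h)

/-- Profiles diverge at such a query only if exactly one of them has type `t`, so monotonicity at
the root need only be checked for pairs involving `t`. -/
theorem monotoneFrom_ask {D D' : TypeDomain E} {f : E} {t : ℝ} {Tyes Tno : ImplTree E F}
    (hD' : D'.vals = Function.update D.vals f ((D.vals f).erase t))
    (hyes : MonotoneFrom Tyes (D.fix f t).profiles) (hno : MonotoneFrom Tno D'.profiles)
    (hmono : ∀ b ∈ D.profiles, ∀ b' ∈ D.profiles, (b f = t ∨ b' f = t) → b f < b' f →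
      f ∈ ((ImplTree.ask f t Tyes Tno).run b').1 → f ∈ ((ImplTree.ask f t Tyes Tno).run b).1) :
    MonotoneFrom (.ask f t Tyes Tno) D.profiles := by
  refine ⟨fun b hb b' hb' hne => hmono b hb b' hb' ?_, fun j => ?_⟩
  · by_contra! hc
    simp [hc.1, hc.2] at hne
  · fin_cases j
    · refine MonotoneFrom.mono hyes ?_
      rintro b ⟨hb, ha⟩
      have : b f = t := by
        by_contra hc
        simp [hc] at ha
      exact this ▸ mem_profiles_fix hb
    · refine MonotoneFrom.mono hno ?_
      rintro b ⟨hb, ha⟩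
      refine mem_profiles_erase hD' hb fun hc => ?_
      simp [hc] at ha

/-- An optimum avoiding `f` here would be a candidate that survives fixing her lowest type. -/
theorem AscendingPick.mem_of_isOptimum {D : TypeDomain E} {f : E} (hf : AscendingPick prec D f)
    {b : E → ℝ} (hb : b ∈ D.profiles) (hbf : b f = D.low f) {P : F} (hP : IsOptimum prec b P) :
    f ∈ P.1 := by
  by_contra hn
  exact hf.2.2 P (hP.selectable hb) hn (hbf ▸ hP.selectable_fix hb f)

theorem DescendingPick.notMem_of_isOptimum {D : TypeDomain E} {f : E}
    (hf : DescendingPick prec D f) {b : E → ℝ} (hb : b ∈ D.profiles) (hbf : b f = D.high f)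
    {P : F} (hP : IsOptimum prec b P) : f ∉ P.1 := fun hm =>
  hf.2.2 P (hP.selectable hb) hm (hbf ▸ hP.selectable_fix hb f)

theorem monotoneFrom_ask_low {D D' : TypeDomain E} {f : E} {Tyes Tno : ImplTree E F}
    (hf : AscendingPick prec D f)
    (hD' : D'.vals = Function.update D.vals f ((D.vals f).erase (D.low f)))
    (hyes : MonotoneFrom Tyes (D.fix f (D.low f)).profiles) (hno : MonotoneFrom Tno D'.profiles)
    (hopt : ∀ b ∈ D.profiles,
      IsOptimum prec b ((ImplTree.ask f (D.low f) Tyes Tno).run b)) :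
    MonotoneFrom (.ask f (D.low f) Tyes Tno) D.profiles := by
  refine monotoneFrom_ask hD' hyes hno fun b hb b' hb' hor hlt _ => ?_
  rcases hor with h | h
  · exact hf.mem_of_isOptimum hb h (hopt b hb)
  · exact absurd (D.low_le (hb f)) (not_le.2 (h ▸ hlt))

theorem monotoneFrom_ask_high {D D' : TypeDomain E} {f : E} {Tyes Tno : ImplTree E F}
    (hf : DescendingPick prec D f)
    (hD' : D'.vals = Function.update D.vals f ((D.vals f).erase (D.high f)))
    (hyes : MonotoneFrom Tyes (D.fix f (D.high f)).profiles) (hno : MonotoneFrom Tno D'.profiles)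
    (hopt : ∀ b ∈ D.profiles,
      IsOptimum prec b ((ImplTree.ask f (D.high f) Tyes Tno).run b)) :
    MonotoneFrom (.ask f (D.high f) Tyes Tno) D.profiles := by
  refine monotoneFrom_ask hD' hyes hno fun b hb b' hb' hor hlt hm => ?_
  rcases hor with h | h
  · exact absurd (D.le_high (hb' f)) (not_le.2 (h ▸ hlt))
  · exact absurd hm (hf.notMem_of_isOptimum hb' h (hopt b' hb'))

/-- Every tree of the algorithm is monotone and returns the optimum. -/
theorem AlgorithmM.monotoneFrom_and_isOptimum [IsStrictTotalOrder F prec] (hF : F.Nonempty)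
    {D : TypeDomain E} {T : ImplTree E F} (h : AlgorithmM prec D T) :
    MonotoneFrom T D.profiles ∧ ∀ b ∈ D.profiles, IsOptimum prec b (T.run b) := by
  induction h with
  | finish D P hP huniq =>
    refine ⟨trivial, fun b hb => ?_⟩
    obtain ⟨Q, hQ⟩ := exists_isOptimum (prec := prec) hF b
    exact huniq Q (hQ.selectable hb) ▸ hQ
  | mixedLow D Dno f Tyes Tno hmix hf hyes hDno hno ihy ihn =>
    have ho := isOptimum_run_ask hDno ihy.2 ihn.2
    exact ⟨monotoneFrom_ask_low hf hDno ihy.1 ihn.1 ho, ho⟩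
  | mixedHigh D Dno f Tyes Tno hmix hlow hf hyes hDno hno ihy ihn =>
    have ho := isOptimum_run_ask hDno ihy.2 ihn.2
    exact ⟨monotoneFrom_ask_high hf hDno ihy.1 ihn.1 ho, ho⟩
  | strong D Dno f Tyes Tno htwo hall hf hyes hDno hno ihy ihn =>
    have ho := isOptimum_run_ask hDno ihy.2 ihn.2
    exact ⟨monotoneFrom_ask_low hf hDno ihy.1 ihn.1 ho, ho⟩

/-- Failure of both kinds of pick is the exchange property of the second obstruction, up to the
requirement that the picked agent be unrevealed. -/
theorem exists_pick_of_not_obstructionTwo {D : TypeDomain E} (h : ¬ ObstructionTwo prec D)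
    (hnt : {P : F | Selectable prec D P}.Nontrivial)
    (hmix : ∃ P : F, Selectable prec D P ∧ ¬ StronglySelectable prec D P) :
    (∃ f, AscendingPick prec D f) ∨ ∃ f, DescendingPick prec D f := by
  by_contra! hc
  refine h ⟨⟨hnt, hmix⟩, ?_⟩
  rintro f ⟨P, P', hP, hP', hfP, hfP'⟩
  constructor
  · by_contra! hn
    refine hc.1 f ⟨?_, ⟨P, hP, hfP⟩, hn⟩
    by_contra! hcard
    -- For a revealed agent fixing her type changes nothing, so `P'` itself is the required exchange
    -- solution.
    exact hn P' hP' hfP' (by rwa [D.fix_eq_self (D.low_mem f) hcard])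
  · by_contra! hn
    refine hc.2 f ⟨?_, ⟨P, hP, hfP⟩, hn⟩
    by_contra! hcard
    exact hn P hP hfP (by rwa [D.fix_eq_self (D.high_mem f) hcard])

theorem exists_ascendingPick_of_not_obstructionOne [IsStrictTotalOrder F prec]
    {D : TypeDomain E} (h : ¬ ObstructionOne prec D)
    (hnt : {P : F | Selectable prec D P}.Nontrivial)
    (hall : ∀ P : F, Selectable prec D P → StronglySelectable prec D P) :
    ∃ f, AscendingPick prec D f := by
  by_contra! hc
  refine h ⟨?_, fun P hP f hf hcard => ?_⟩
  · by_contra! hn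
    obtain ⟨P, hP, Q, hQ, hPQ⟩ := hnt
    exact hPQ (Selectable.eq_of_card_le_one hP hQ (hn P (hall P hP)) (hn Q (hall Q hQ)))
  · by_contra! hn
    exact hc f ⟨hcard, ⟨P, hP.1, hf⟩, fun Q hQ hfQ => hn Q (hall Q hQ) hfQ⟩

/-- The algorithm can be carried out from every domain without obstructed subdomains. -/
theorem exists_algorithmM [Fintype E] [IsStrictTotalOrder F prec] (hF : F.Nonempty)
    (D : TypeDomain E) (h : ∀ D' : TypeDomain E, D'.IsSubdomain D →
      ¬ ObstructionOne prec D' ∧ ¬ ObstructionTwo prec D') :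
    ∃ T : ImplTree E F, AlgorithmM prec D T := by
  -- The total number of remaining types drops with either answer, since only agents with at least
  -- two types are asked.
  induction hn : ∑ e, (D.vals e).card using Nat.strong_induction_on generalizing D with
  | _ n ih =>
  subst hn
  have hstep : ∀ f s, (hs : s.Nonempty) → s ⊂ D.vals f →
      ∃ T : ImplTree E F, AlgorithmM prec (D.replace f s hs) T := by
    intro f s hs hss
    have hsub := D.replace_isSubdomain hs hss.subset
    refine ih _ ?_ _ (fun D' hD' => h D' (hD'.trans hsub)) rfl
    refine Finset.sum_lt_sum (fun e _ => Finset.card_le_card (hsub e)) ⟨f, Finset.mem_univ f, ?_⟩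
    rw [D.replace_vals_self]
    exact Finset.card_lt_card hss
  have hask : ∀ f t, 1 < (D.vals f).card → t ∈ D.vals f →
      (∃ T : ImplTree E F, AlgorithmM prec (D.fix f t) T) ∧
      ∃ D' : TypeDomain E, D'.vals = Function.update D.vals f ((D.vals f).erase t) ∧
        ∃ T : ImplTree E F, AlgorithmM prec D' T := by
    intro f t hc ht
    obtain ⟨u, hu, hut⟩ := Finset.exists_mem_ne hc t
    refine ⟨hstep f {t} (Finset.singleton_nonempty t) ?_, D.replace f _ ⟨u, ?_⟩, rfl,
      hstep f _ _ (Finset.erase_ssubset ht)⟩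
    · rw [Finset.ssubset_iff_of_subset (Finset.singleton_subset_iff.2 ht)]
      exact ⟨u, hu, by simpa using hut⟩
    · exact Finset.mem_erase.2 ⟨hut, hu⟩
  by_cases hnt : {P : F | Selectable prec D P}.Nontrivial
  · by_cases hmix : ∃ P : F, Selectable prec D P ∧ ¬ StronglySelectable prec D P
    · by_cases hlow : ∃ f, AscendingPick prec D f
      · obtain ⟨f, hf⟩ := hlow
        obtain ⟨⟨Ty, hy⟩, D', hD', Tn, hTn⟩ := hask f _ hf.1 (D.low_mem f)
        exact ⟨_, .mixedLow D D' f Ty Tn hmix hf hy hD' hTn⟩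
      · obtain ⟨f, hf⟩ := (exists_pick_of_not_obstructionTwo (h D (.refl D)).2 hnt
          hmix).resolve_left hlow
        obtain ⟨⟨Ty, hy⟩, D', hD', Tn, hTn⟩ := hask f _ hf.1 (D.high_mem f)
        exact ⟨_, .mixedHigh D D' f Ty Tn hmix hlow hf hy hD' hTn⟩
    · push Not at hmix
      obtain ⟨f, hf⟩ := exists_ascendingPick_of_not_obstructionOne (h D (.refl D)).1 hnt hmix
      obtain ⟨⟨Ty, hy⟩, D', hD', Tn, hTn⟩ := hask f _ hf.1 (D.low_mem f)
      exact ⟨_, .strong D D' f Ty Tn hnt hmix hf hy hD' hTn⟩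
  -- Any profile would do; its optimum shows that there is at least one candidate.
  · obtain ⟨P, hP⟩ := exists_isOptimum (prec := prec) hF D.low
    have hPs : Selectable prec D P := hP.selectable D.low_mem
    exact ⟨_, .finish D P hPs fun Q hQ => Set.not_nontrivial_iff.1 hnt hQ hPs⟩

end Algorithm

end SetSystem

theorem mainTheorem4 {E : Type*} [Fintype E] [DecidableEq E]
    (F : Finset (Finset E)) (hF : F.Nonempty)
    (prec : F → F → Prop) (hprec : IsStrictTotalOrder F prec)
    (D : TypeDomain E)
    (hD : ∀ e, ∃ l m h : ℝ, l < m ∧ m < h ∧ D.vals e ⊆ {l, m, h}) :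
    ((∃ M : SetSystem.Mechanism F, SetSystem.IsOSP D M ∧ SetSystem.IsOptimal prec D M) ↔
      ¬ ∃ D' : TypeDomain E, D'.IsSubdomain D ∧
        (SetSystem.ObstructionOne prec D' ∨ SetSystem.ObstructionTwo prec D')) ∧
    ((∃ M : SetSystem.Mechanism F, SetSystem.IsOSP D M ∧ SetSystem.IsOptimal prec D M) →
      (∀ D' : TypeDomain E, D'.IsSubdomain D →
        ∃ T : ImplTree E F, SetSystem.AlgorithmM prec D' T) ∧
      ∀ T : ImplTree E F, SetSystem.AlgorithmM prec D T →
        ∃ M : SetSystem.Mechanism F, M.map Prod.fst = T ∧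
          SetSystem.IsOSP D M ∧ SetSystem.IsOptimal prec D M) := by
  have halg : (¬ ∃ D' : TypeDomain E, D'.IsSubdomain D ∧
      (SetSystem.ObstructionOne prec D' ∨ SetSystem.ObstructionTwo prec D')) →
      ∀ D' : TypeDomain E, D'.IsSubdomain D →
        ∃ T : ImplTree E F, SetSystem.AlgorithmM prec D' T := fun h D' hD' =>
    SetSystem.exists_algorithmM hF D' fun D'' hD'' =>
      not_or.1 fun hO => h ⟨D'', hD''.trans hD', hO⟩
  have hmech : ∀ T : ImplTree E F, SetSystem.AlgorithmM prec D T →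
      ∃ M : SetSystem.Mechanism F, M.map Prod.fst = T ∧
        SetSystem.IsOSP D M ∧ SetSystem.IsOptimal prec D M := fun T hT =>
    have h := hT.monotoneFrom_and_isOptimum hF
    h.1.exists_mechanism h.2 hD
  have hobs : (∃ M : SetSystem.Mechanism F, SetSystem.IsOSP D M ∧ SetSystem.IsOptimal prec D M) →
      ¬ ∃ D' : TypeDomain E, D'.IsSubdomain D ∧
        (SetSystem.ObstructionOne prec D' ∨ SetSystem.ObstructionTwo prec D') := by
    rintro ⟨M, hM, hopt⟩ ⟨D', hD', hO⟩
    exact SetSystem.not_obstruction_of_mechanism hM hopt hD' hO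
  refine ⟨⟨hobs, fun h => ?_⟩, fun h => ⟨halg (hobs h), hmech⟩⟩
  obtain ⟨T, hT⟩ := halg h D (.refl D)
  obtain ⟨M, -, hM⟩ := hmech T hT
  exact ⟨M, hM⟩
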